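/- Let $d,k\ge 1$ be integers, $\tilde k=\min\{k,d\}$ and $\lambda>0$. Let $\mathcal S_+^d$ be the cone of real symmetric positive semidefinite $d\times d$ matrices. For $\boldsymbol X\in\mathcal S_+^d$ with eigenvalues $\sigma_1\ge\cdots\ge\sigma_d\ge 0$ put $\Gamma(\boldsymbol X;\lambda)=\sum_{i=1}^{\tilde k}\frac{1}{\sigma_i+\lambda}$, and let $\operatorname{conv}\Gamma$ be the convex envelope of $\Gamma$ on $\mathcal S_+^d$, that is, the pointwise supremum of all convex functions on $\mathcal S_+^d$ that lie below $\Gamma$. Then $\operatorname{conv}\Gamma$ is the greatest convex function on $\mathcal S_+^d$ below $\Gamma$, and for every $\boldsymbol X\in\mathcal S_+^d$ with eigenvalues $\sigma_1\ge\cdots\ge\sigma_d\ge0$ the following hold. There is a unique integer $\eta$, $0\le\eta\le\tilde k-1$, such that (with $\sigma_0=\infty$) $$\sigma_\eta>\frac{1}{\tilde k-\eta}\sum_{i=\eta+1}^d\sigma_i\ge\sigma_{\eta+1}.$$ With this $\eta$: (i) $$\operatorname{conv}\Gamma(\boldsymbol X;\lambda)=\sum_{i=1}^{\eta}\frac{1}{\sigma_i+\lambda}+\frac{(\tilde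 k-\eta)^2}{\sum_{i=\eta+1}^d\sigma_i+(\tilde k-\eta)\lambda}.$$ (ii) For every eigen-decomposition $\boldsymbol X=\boldsymbol Q\operatorname{Diag}(\boldsymbol\sigma)\boldsymbol Q^\top$ with $\boldsymbol Q$ orthogonal, the symmetric matrix $\boldsymbol W=\boldsymbol Q\operatorname{Diag}(\boldsymbol\varsigma)\boldsymbol Q^\top$ is a subgradient of $\operatorname{conv}\Gamma(\cdot;\lambda)$ at $\boldsymbol X$, i.e. $\operatorname{conv}\Gamma(\boldsymbol Y;\lambda)\ge\operatorname{conv}\Gamma(\boldsymbol X;\lambda)+\operatorname{tr}(\boldsymbol W(\boldsymbol Y-\boldsymbol X))$ for all $\boldsymbol Y\in\mathcal S_+^d$, where $$\varsigma_i=-\frac{1}{(\sigma_i+\lambda)^2}\ \ (1\le i\le\eta),\qquad \varsigma_i=-\left(\frac{\tilde k-\eta}{\sum_{j=\eta+1}^d\sigma_j+(\tilde k-\eta)\lambda}\right)^{2}\ \ (\eta+1\le i\le d).$$ -/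

import Mathlib

open scoped Matrix

/-- The convex envelope of `f` on `S`, as the pointwise supremum of all convex functions on `S`
that lie below `f` on `S`. -/
noncomputable def convexEnvelopeOn {E : Type*} [AddCommGroup E] [Module ℝ E]
    (S : Set E) (f : E → ℝ) (x : E) : ℝ :=
  sSup {y : ℝ | ∃ h : E → ℝ, ConvexOn ℝ S h ∧ (∀ z ∈ S, h z ≤ f z) ∧ h x = y}

/-- `g` is the greatest convex function on `S` that lies below `f` on `S`. -/
structure IsConvexEnvelopeOn {E : Type*} [AddCommGroup E] [Module ℝ E]
    (S : Set E) (f g : E → ℝ) : Prop where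
  convexOn : ConvexOn ℝ S g
  le : ∀ x ∈ S, g x ≤ f x
  greatest : ∀ h : E → ℝ, ConvexOn ℝ S h → (∀ x ∈ S, h x ≤ f x) → ∀ x ∈ S, h x ≤ g x

/-- The cone of real symmetric positive semidefinite `d × d` matrices. -/
def psdCone (d : ℕ) : Set (Matrix (Fin d) (Fin d) ℝ) :=
  {X | X.PosSemidef}

/-- The eigenvalues, with multiplicity and in nonincreasing order, of a real symmetric matrix. -/
noncomputable def sortedEigenvalues {d : ℕ} {X : Matrix (Fin d) (Fin d) ℝ}
    (hX : X.IsHermitian) (i : Fin d) : ℝ :=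
  hX.eigenvalues₀ (Fin.cast (Fintype.card_fin d).symm i)

open Classical in
/-- The sum of `1 / (σ_i + lam)` over the `m` largest eigenvalues `σ_i` of `X`
(the value `0` is given to matrices that are not symmetric; these lie outside the domain). -/
noncomputable def Gam {d : ℕ} (m : ℕ) (lam : ℝ) (X : Matrix (Fin d) (Fin d) ℝ) : ℝ :=
  if hX : X.IsHermitian then
    ∑ i : Fin d with i.val < m, 1 / (sortedEigenvalues hX i + lam)
  else 0

/-- `W` is a subgradient at `X`, in the space of real symmetric matrices with the inner product
`⟨A, B⟩ = tr (Aᵀ B)`, of the function `f` with domain `psdCone d`. -/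
def IsSubgradient {d : ℕ} (f : Matrix (Fin d) (Fin d) ℝ → ℝ)
    (X W : Matrix (Fin d) (Fin d) ℝ) : Prop :=
  W.IsSymm ∧ ∀ Y ∈ psdCone d, f X + (Wᵀ * (Y - X)).trace ≤ f Y

/-- `X = Q Diag(σ) Qᵀ` with `Q` orthogonal and `σ` in nonincreasing order. -/
structure IsEigenDecomposition {d : ℕ} (X Q : Matrix (Fin d) (Fin d) ℝ) (σ : Fin d → ℝ) :
    Prop where
  orthogonal : Q ∈ Matrix.orthogonalGroup (Fin d) ℝ
  antitone : Antitone σ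
  eq : X = Q * Matrix.diagonal σ * Qᵀ

/-- The sum of `σ_i` over the (one-based) indices `i = η + 1, …, d`. -/
def tailSum {d : ℕ} (σ : Fin d → ℝ) (η : ℕ) : ℝ :=
  ∑ i : Fin d with η ≤ i.val, σ i

/-- With one-based indices and `σ_0 = ∞`:
`0 ≤ η ≤ m - 1` and `σ_η > (1 / (m - η)) ∑_{i = η + 1}^d σ_i ≥ σ_{η + 1}`. -/
structure IsBreakIndex {d : ℕ} (m : ℕ) (σ : Fin d → ℝ) (η : ℕ) : Prop where
  lt : η < m
  above : ∀ i : Fin d, i.val + 1 = η → 1 / ((m : ℝ) - η) * tailSum σ η < σ i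
  below : ∀ i : Fin d, i.val = η → σ i ≤ 1 / ((m : ℝ) - η) * tailSum σ η

/-- `∑_{i ≤ η} 1 / (σ_i + lam) + (m - η)² / (∑_{i > η} σ_i + (m - η) lam)`. -/
noncomputable def envelopeValue {d : ℕ} (m : ℕ) (lam : ℝ) (σ : Fin d → ℝ) (η : ℕ) : ℝ :=
  ∑ i : Fin d with i.val < η, 1 / (σ i + lam)
    + ((m : ℝ) - η) ^ 2 / (tailSum σ η + ((m : ℝ) - η) * lam)

/-- The eigenvalues of the subgradient: `- 1 / (σ_i + lam)²` for `i ≤ η`, and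
`- ((m - η) / (∑_{j > η} σ_j + (m - η) lam))²` for all `i > η`. -/
noncomputable def subgradValue {d : ℕ} (m : ℕ) (lam : ℝ) (σ : Fin d → ℝ) (η : ℕ)
    (i : Fin d) : ℝ :=
  if i.val < η then -(1 / (σ i + lam)) ^ 2
  else -(((m : ℝ) - η) / (tailSum σ η + ((m : ℝ) - η) * lam)) ^ 2

/-!
Lower bound on the values of `Γ`: by von Neumann's trace inequality (deduced from Birkhoff's
theorem on doubly stochastic matrices) and the tangent line inequality for `t ↦ 1 / (t + lam)`,
the affine function with slope `W` and value `envelopeValue` at `X` lies below `Γ`, hence below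
its convex envelope.

Upper bound: let `τ` agree with `σ` up to the index `η` and be constantly
`(1 / (m - η)) ∑_{i > η} σ_i` afterwards. The break index condition says `σ ≤ τ`, and the ratios
`σ_i / τ_i` sum to `m`, so they form a point of a hypersimplex and `X = Q Diag(σ) Qᵀ` is a convex
combination of matrices `Q Diag(τ 1_S) Qᵀ` with `|S| = m` and `{1, …, η} ⊆ S`. On each of these
`Γ` is at most `∑_{i ∈ S} 1 / (τ_i + lam) = envelopeValue`.

The break index itself is the least `η` with `σ_{η + 1} ≤ (1 / (m - η)) ∑_{i > η} σ_i`: this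
inequality at one index implies it at all later ones, and its failure at `η - 1` is equivalent to
the strict inequality required of `σ_η`.
-/

section ConvexEnvelope

variable {E : Type*} [AddCommGroup E] [Module ℝ E] {S : Set E} {f h : E → ℝ} {x : E}

theorem le_convexEnvelopeOn (hh : ConvexOn ℝ S h) (hf : ∀ z ∈ S, h z ≤ f z) (hx : x ∈ S) :
    h x ≤ convexEnvelopeOn S f x := by
  refine le_csSup ⟨f x, ?_⟩ ⟨h, hh, hf, rfl⟩
  rintro _ ⟨g, -, hg, rfl⟩
  exact hg x hx

theorem convexEnvelopeOn_le {c : ℝ} (hh : ConvexOn ℝ S h) (hf : ∀ z ∈ S, h z ≤ f z)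
    (hc : ∀ g : E → ℝ, ConvexOn ℝ S g → (∀ z ∈ S, g z ≤ f z) → g x ≤ c) :
    convexEnvelopeOn S f x ≤ c := by
  refine csSup_le ⟨_, h, hh, hf, rfl⟩ ?_
  rintro _ ⟨g, hg, hgf, rfl⟩
  exact hc g hg hgf

theorem isConvexEnvelopeOn_convexEnvelopeOn (hh : ConvexOn ℝ S h) (hf : ∀ z ∈ S, h z ≤ f z) :
    IsConvexEnvelopeOn S f (convexEnvelopeOn S f) where
  convexOn := by
    refine ⟨hh.1, fun x hx y hy a b ha hb hab => convexEnvelopeOn_le hh hf fun g hg hgf => ?_⟩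
    calc g (a • x + b • y) ≤ a • g x + b • g y := hg.2 hx hy ha hb hab
      _ ≤ a • convexEnvelopeOn S f x + b • convexEnvelopeOn S f y := by
        gcongr <;> exact le_convexEnvelopeOn hg hgf ‹_›
  le x hx := convexEnvelopeOn_le hh hf fun _ _ hgf => hgf x hx
  greatest _ hg hgf _ hx := le_convexEnvelopeOn hg hgf hx

end ConvexEnvelope

section Hypersimplex

variable {ι : Type*} [Fintype ι] {A : Set ι} {m : ℕ} {x : ι → ℝ}

/-- The face of the hypersimplex `{x ∈ [0, 1]^ι | ∑ i, x i = m}` on which the coordinates in `A`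
are equal to `1`. Its vertices are the indicators of the `m`-element sets containing `A`. -/
def hypersimplexFace (A : Set ι) (m : ℕ) : Set (ι → ℝ) :=
  Set.Icc 0 1 ∩ {x | ∑ i, x i = m} ∩ A.pi fun _ => {1}

theorem indicator_one_mem_hypersimplexFace {S : Finset ι} (hS : S.card = m) (hA : A ⊆ S) :
    (S : Set ι).indicator 1 ∈ hypersimplexFace A m := by
  classical
  refine ⟨⟨⟨fun i => ?_, fun i => ?_⟩, ?_⟩, fun i hi => ?_⟩
  · exact Set.indicator_nonneg (fun _ _ => zero_le_one) i
  · exact Set.indicator_le_self' (fun _ _ => zero_le_one) i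
  · simp [Set.indicator_apply, hS]
  · simp [Set.indicator_of_mem (hA hi)]

theorem convex_hypersimplexFace : Convex ℝ (hypersimplexFace A m) :=
  have sum_isLinear : IsLinearMap ℝ fun x : ι → ℝ => ∑ i, x i :=
    ⟨fun _ _ => Finset.sum_add_distrib, fun _ _ => (Finset.mul_sum _ _ _).symm⟩
  ((convex_Icc 0 1).inter (convex_hyperplane sum_isLinear _)).inter
    (convex_pi fun _ _ => convex_singleton 1)

theorem isCompact_hypersimplexFace : IsCompact (hypersimplexFace A m) :=
  have isClosed_sum_eq : IsClosed {x : ι → ℝ | ∑ i, x i = m} :=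
    isClosed_eq (continuous_finsetSum _ fun i _ => continuous_apply i) continuous_const
  (isCompact_Icc.inter_right isClosed_sum_eq).inter_right
    (isClosed_set_pi fun _ _ => isClosed_singleton)

theorem exists_ne_mem_Ioo_of_mem_hypersimplexFace (hx : x ∈ hypersimplexFace A m) {i : ι}
    (hi : x i ∈ Set.Ioo 0 1) : ∃ j ≠ i, x j ∈ Set.Ioo 0 1 := by
  classical
  obtain ⟨⟨⟨h0, h1⟩, hsum⟩, -⟩ := hx
  by_contra! hne
  have integral (j : ι) (hj : j ≠ i) : x j = if x j = 1 then 1 else 0 := by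
    have : ¬(0 < x j ∧ x j < 1) := hne j hj
    have : 0 ≤ x j := h0 j
    have : x j ≤ 1 := h1 j
    clear h0 h1
    grind
  have sum_erase : ∑ j ∈ Finset.univ.erase i, x j
      = ({j ∈ Finset.univ.erase i | x j = 1}.card : ℝ) := by
    rw [← Finset.sum_boole]
    exact Finset.sum_congr rfl fun j hj => integral j (Finset.ne_of_mem_erase hj)
  have eq_intCast : x i = ((m - {j ∈ Finset.univ.erase i | x j = 1}.card : ℤ) : ℝ) := by
    have := Finset.add_sum_erase Finset.univ x (Finset.mem_univ i)
    push_cast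
    linarith [hsum.symm]
  rw [eq_intCast] at hi
  have : (0 : ℤ) < _ ∧ _ < (1 : ℤ) := ⟨by exact_mod_cast hi.1, by exact_mod_cast hi.2⟩
  omega

theorem add_smul_single_sub_single_mem_hypersimplexFace [DecidableEq ι]
    (hx : x ∈ hypersimplexFace A m) {i j : ι} (hij : i ≠ j) (hi : x i < 1) (hj : x j < 1) {t : ℝ}
    (hti : x i + t ∈ Set.Icc 0 1) (htj : x j - t ∈ Set.Icc 0 1) :
    x + t • (Pi.single i 1 - Pi.single j 1) ∈ hypersimplexFace A m := by
  obtain ⟨⟨hIcc, hsum⟩, hA⟩ := hx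
  have apply_eq (l : ι) : (x + t • (Pi.single i 1 - Pi.single j 1 : ι → ℝ)) l
      = if l = i then x i + t else if l = j then x j - t else x l := by
    rcases eq_or_ne l i with rfl | hl
    · simp [hij]
    rcases eq_or_ne l j with rfl | hl'
    · simp [hl, sub_eq_add_neg]
    · simp [hl, hl']
  refine ⟨⟨?_, ?_⟩, fun l hl => ?_⟩
  · rw [← Set.pi_univ_Icc] at hIcc ⊢
    intro l _
    rw [apply_eq]
    split_ifs
    exacts [hti, htj, hIcc l trivial]
  · simpa [Finset.sum_add_distrib, ← Finset.mul_sum] using hsum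
  · have hl1 : x l = 1 := hA l hl
    rw [Set.mem_singleton_iff, apply_eq, if_neg, if_neg, hl1]
    · rintro rfl
      exact hj.ne hl1
    · rintro rfl
      exact hi.ne hl1

theorem eq_zero_or_eq_one_of_mem_extremePoints_hypersimplexFace
    (hx : x ∈ (hypersimplexFace A m).extremePoints ℝ) (i : ι) : x i = 0 ∨ x i = 1 := by
  classical
  rw [mem_extremePoints_iff_left] at hx
  obtain ⟨hmem, hext⟩ := hx
  have h0 : 0 ≤ x i := hmem.1.1.1 i
  have h1 : x i ≤ 1 := hmem.1.1.2 i
  by_contra! hi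
  have hi : x i ∈ Set.Ioo 0 1 := ⟨h0.lt_of_ne' hi.1, h1.lt_of_ne hi.2⟩
  obtain ⟨j, hji, hj⟩ := exists_ne_mem_Ioo_of_mem_hypersimplexFace hmem hi
  obtain ⟨t, ht, hti, htj⟩ : ∃ t, 0 < t ∧ t ≤ min (x i) (1 - x i) ∧ t ≤ min (x j) (1 - x j) :=
    ⟨min (min (x i) (1 - x i)) (min (x j) (1 - x j)),
      by simp only [lt_min_iff, sub_pos]; exact ⟨hi, hj⟩, min_le_left _ _, min_le_right _ _⟩
  rw [le_min_iff] at hti htj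
  have perturb (s : ℝ) (hs : |s| ≤ t) :
      x + s • (Pi.single i 1 - Pi.single j 1) ∈ hypersimplexFace A m := by
    rw [abs_le] at hs
    exact add_smul_single_sub_single_mem_hypersimplexFace hmem hji.symm hi.2 hj.2
      ⟨by linarith, by linarith⟩ ⟨by linarith, by linarith⟩
  have eq_x := hext _ (perturb t (abs_of_pos ht).le) _ (perturb (-t) (by simp [abs_of_pos ht]))
    ⟨1 / 2, 1 / 2, by norm_num, by norm_num, by norm_num, by module⟩
  have := congrFun eq_x i
  simp [hji.symm, ht.ne'] at this

theorem hypersimplexFace_subset_convexHull :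
    hypersimplexFace A m ⊆
      convexHull ℝ {y | ∃ S : Finset ι, S.card = m ∧ A ⊆ S ∧ y = (S : Set ι).indicator 1} := by
  have isClosed_hull : IsClosed (convexHull ℝ
      {y | ∃ S : Finset ι, S.card = m ∧ A ⊆ S ∧ y = (S : Set ι).indicator (1 : ι → ℝ)}) := by
    refine ((Set.finite_range
      fun S : Finset ι => (S : Set ι).indicator (1 : ι → ℝ)).subset ?_).isClosed_convexHull _
    rintro _ ⟨S, -, -, rfl⟩
    exact ⟨S, rfl⟩
  rw [← closure_convexHull_extremePoints isCompact_hypersimplexFace convex_hypersimplexFace]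
  refine closure_minimal (convexHull_mono fun x hx => ?_) isClosed_hull
  have eq_ite (i : ι) : x i = if x i = 1 then 1 else 0 := by
    rcases eq_zero_or_eq_one_of_mem_extremePoints_hypersimplexFace hx i with h | h <;> simp [h]
  obtain ⟨⟨-, hsum⟩, hA⟩ := hx.1
  refine ⟨({i | x i = 1} : Finset ι), ?_, fun i hi => by simpa using hA i hi, ?_⟩
  · rw [Set.mem_ofPred_eq, Finset.sum_congr rfl fun i _ => eq_ite i, Finset.sum_boole] at hsum
    exact_mod_cast hsum
  · funext i
    simpa [Set.indicator_apply] using eq_ite i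

end Hypersimplex

section TraceInequality

open Matrix

variable {n : Type*} [Fintype n] [DecidableEq n]

theorem dotProduct_mulVec_le_of_mem_doublyStochastic {R : Type*} [Field R] [LinearOrder R]
    [IsStrictOrderedRing R] {M : Matrix n n R} (hM : M ∈ doublyStochastic R n) {w μ : n → R}
    (h : Monovary w μ) : w ⬝ᵥ M *ᵥ μ ≤ w ⬝ᵥ μ := by
  have isLinear : IsLinearMap R fun M : Matrix n n R => w ⬝ᵥ M *ᵥ μ :=
    ⟨fun A B => by rw [add_mulVec, dotProduct_add], fun c A => by rw [smul_mulVec, dotProduct_smul]⟩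
  suffices (doublyStochastic R n : Set (Matrix n n R)) ⊆ {M | w ⬝ᵥ M *ᵥ μ ≤ w ⬝ᵥ μ} from this hM
  rw [doublyStochastic_eq_convexHull_permMatrix]
  refine convexHull_min ?_ (convex_halfSpace_le isLinear _)
  rintro _ ⟨π, rfl⟩
  rw [Set.mem_ofPred_eq, permMatrix_mulVec]
  exact h.sum_mul_comp_perm_le_sum_mul

variable {Q V : Matrix n n ℝ} {w μ : n → ℝ}

theorem hadamard_self_mem_doublyStochastic (hQ : Q ∈ orthogonalGroup n ℝ) :
    Q ⊙ Q ∈ doublyStochastic ℝ n := by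
  have rows := (mem_orthogonalGroup_iff n ℝ).1 hQ
  have cols := (mem_orthogonalGroup_iff' n ℝ).1 hQ
  rw [mem_doublyStochastic_iff_sum]
  refine ⟨fun i j => mul_self_nonneg _, fun i => ?_, fun j => ?_⟩
  · simpa [mul_apply] using congrFun₂ rows i i
  · simpa [mul_apply] using congrFun₂ cols j j

theorem transpose_mul_mem_orthogonalGroup (hQ : Q ∈ orthogonalGroup n ℝ)
    (hV : V ∈ orthogonalGroup n ℝ) : Qᵀ * V ∈ orthogonalGroup n ℝ :=
  mul_mem (Unitary.star_mem hQ) hV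

theorem trace_conj_diagonal_mul_conj_diagonal :
    (Q * diagonal w * Qᵀ * (V * diagonal μ * Vᵀ)).trace
      = w ⬝ᵥ ((Qᵀ * V) ⊙ (Qᵀ * V)) *ᵥ μ := by
  rw [dotProduct_mulVec, dotProduct_vecMul_hadamard, Matrix.mul_assoc Q, Matrix.mul_assoc Q,
    trace_mul_comm]
  simp only [transpose_mul, transpose_transpose, diagonal_transpose, Matrix.mul_assoc]

theorem trace_conj_diagonal_mul_conj_diagonal_self (hQ : Q ∈ orthogonalGroup n ℝ) :
    (Q * diagonal w * Qᵀ * (Q * diagonal μ * Qᵀ)).trace = w ⬝ᵥ μ := by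
  have hQQ : Qᵀ * Q = 1 := (mem_orthogonalGroup_iff' n ℝ).1 hQ
  rw [trace_conj_diagonal_mul_conj_diagonal, hQQ, one_hadamard, diag_one, diagonal_one',
    one_mulVec]

theorem trace_conj_diagonal_mul_conj_diagonal_le (hQ : Q ∈ orthogonalGroup n ℝ)
    (hV : V ∈ orthogonalGroup n ℝ) (h : Monovary w μ) :
    (Q * diagonal w * Qᵀ * (V * diagonal μ * Vᵀ)).trace ≤ w ⬝ᵥ μ :=
  trace_conj_diagonal_mul_conj_diagonal.trans_le <|
    dotProduct_mulVec_le_of_mem_doublyStochastic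
      (hadamard_self_mem_doublyStochastic (transpose_mul_mem_orthogonalGroup hQ hV)) h

end TraceInequality

section Spectrum

open Matrix

theorem exists_perm_of_map_univ_eq {ι α : Type*} [Fintype ι] {f g : ι → α}
    (h : Finset.univ.val.map f = Finset.univ.val.map g) : ∃ e : Equiv.Perm ι, f = g ∘ e := by
  classical
  have card_fiber (c : α) : Fintype.card {i // f i = c} = Fintype.card {i // g i = c} := by
    have := congrArg (Multiset.count c) h
    rw [Multiset.count_map, Multiset.count_map] at this
    rw [Fintype.card_subtype, Fintype.card_subtype]
    simpa [Finset.card_def, eq_comm] using this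
  exact ⟨Equiv.ofFiberEquiv fun c => Fintype.equivOfCardEq (card_fiber c),
    funext fun i => (Equiv.ofFiberEquiv_map _ i).symm⟩

section Orthogonal

variable {n : Type*} [Fintype n] [DecidableEq n] {Q V : Matrix n n ℝ} {τ μ : n → ℝ}

theorem roots_charpoly_conj_diagonal (hQ : Q ∈ orthogonalGroup n ℝ) :
    (Q * diagonal τ * Qᵀ).charpoly.roots = Finset.univ.val.map τ := by
  have hQQ : Qᵀ * Q = 1 := (mem_orthogonalGroup_iff' n ℝ).1 hQ
  rw [charpoly_mul_comm, ← Matrix.mul_assoc, hQQ, Matrix.one_mul, charpoly_diagonal]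
  have := Polynomial.roots_multiset_prod_X_sub_C (Finset.univ.val.map τ)
  rwa [Multiset.map_map] at this

theorem exists_perm_of_conj_diagonal_eq (hQ : Q ∈ orthogonalGroup n ℝ)
    (hV : V ∈ orthogonalGroup n ℝ) (h : Q * diagonal τ * Qᵀ = V * diagonal μ * Vᵀ) :
    ∃ e : Equiv.Perm n, τ = μ ∘ e :=
  exists_perm_of_map_univ_eq <| by
    rw [← roots_charpoly_conj_diagonal hQ, h, roots_charpoly_conj_diagonal hV]

theorem isHermitian_conj_diagonal : (Q * diagonal τ * Qᵀ).IsHermitian := by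
  simp [IsHermitian, conjTranspose_eq_transpose_of_trivial, Matrix.mul_assoc]

theorem posSemidef_conj_diagonal_iff (hQ : Q ∈ orthogonalGroup n ℝ) :
    (Q * diagonal τ * Qᵀ).PosSemidef ↔ ∀ i, 0 ≤ τ i := by
  have isUnit_Q : IsUnit Q := ⟨Unitary.toUnits ⟨Q, hQ⟩, rfl⟩
  rw [← posSemidef_diagonal_iff, ← conjTranspose_eq_transpose_of_trivial, ← star_eq_conjTranspose,
    isUnit_Q.posSemidef_star_right_conjugate_iff]

end Orthogonal

variable {d : ℕ} {X : Matrix (Fin d) (Fin d) ℝ}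

theorem antitone_sortedEigenvalues (hX : X.IsHermitian) : Antitone (sortedEigenvalues hX) :=
  fun _ _ hij => hX.eigenvalues₀_antitone hij

theorem exists_perm_sortedEigenvalues_eq (hX : X.IsHermitian) :
    ∃ e : Equiv.Perm (Fin d), sortedEigenvalues hX = hX.eigenvalues ∘ e := by
  refine ⟨(finCongr (Fintype.card_fin d).symm).trans (Fintype.equivOfCardEq (Fintype.card_fin _)),
    funext fun i => ?_⟩
  simp [sortedEigenvalues, IsHermitian.eigenvalues]

theorem exists_isEigenDecomposition_sortedEigenvalues (hX : X.IsHermitian) :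
    ∃ V, IsEigenDecomposition X V (sortedEigenvalues hX) := by
  obtain ⟨e, he⟩ := exists_perm_sortedEigenvalues_eq hX
  set U : Matrix (Fin d) (Fin d) ℝ := ↑hX.eigenvectorUnitary
  have hU : U ∈ orthogonalGroup (Fin d) ℝ := hX.eigenvectorUnitary.2
  have hXU : X = U * diagonal hX.eigenvalues * Uᵀ := by
    conv_lhs => rw [hX.spectral_theorem]
    simp [U, Unitary.conjStarAlgAut_apply, star_eq_conjTranspose,
      conjTranspose_eq_transpose_of_trivial]
  refine ⟨U.submatrix id e, ?_, antitone_sortedEigenvalues hX, ?_⟩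
  · rw [mem_orthogonalGroup_iff] at hU ⊢
    rw [← hU]
    exact submatrix_mul_equiv U Uᵀ id e id
  · rw [he, ← submatrix_diagonal_equiv, transpose_submatrix, submatrix_mul_equiv,
      submatrix_mul_equiv, ← hXU, submatrix_id_id]

variable {Q : Matrix (Fin d) (Fin d) ℝ} {σ : Fin d → ℝ}

theorem IsEigenDecomposition.nonneg (h : IsEigenDecomposition X Q σ) (hX : X.PosSemidef)
    (i : Fin d) : 0 ≤ σ i :=
  (posSemidef_conj_diagonal_iff h.orthogonal).1 (h.eq ▸ hX) i

theorem sortedEigenvalues_nonneg (hX : X.PosSemidef) (i : Fin d) :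
    0 ≤ sortedEigenvalues hX.isHermitian i :=
  have ⟨_, hV⟩ := exists_isEigenDecomposition_sortedEigenvalues hX.isHermitian
  hV.nonneg hX i

end Spectrum

section Gam

open Matrix

theorem sum_le_sum_of_isLowerSet {ι M : Type*} [LinearOrder ι] [AddCommMonoid M] [PartialOrder M]
    [IsOrderedAddMonoid M] {f : ι → M} (hf : Monotone f) {I S : Finset ι}
    (hI : IsLowerSet (I : Set ι)) (hIS : I.card = S.card) : ∑ i ∈ I, f i ≤ ∑ i ∈ S, f i := by
  let e := Finset.equivOfCardEq (Finset.card_sdiff_comm hIS)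
  have le_e (i : {i // i ∈ I \ S}) : i.1 ≤ (e i).1 := by
    have hi := Finset.mem_sdiff.1 i.2
    have hei := Finset.mem_sdiff.1 (e i).2
    by_contra! hlt
    exact hei.2 (hI hlt.le hi.1)
  have sum_sdiff_le : ∑ i ∈ I \ S, f i ≤ ∑ i ∈ S \ I, f i := by
    rw [← Finset.sum_coe_sort (I \ S), ← Finset.sum_coe_sort (S \ I), ← e.sum_comp]
    exact Finset.sum_le_sum fun i _ => hf (le_e i)
  rw [← Finset.sum_inter_add_sum_sdiff I S, ← Finset.sum_inter_add_sum_sdiff S I,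
    Finset.inter_comm S I]
  gcongr

theorem convex_psdCone (d : ℕ) : Convex ℝ (psdCone d) :=
  fun _ hX _ hY _ _ ha hb _ => (hX.smul ha).add (hY.smul hb)

variable {d m : ℕ} {lam : ℝ}

theorem card_filter_val_lt (hmd : m ≤ d) : Finset.card {i : Fin d | i.val < m} = m := by
  rw [Fin.card_filter_val_lt, min_eq_right hmd]

theorem Gam_eq_sum {X : Matrix (Fin d) (Fin d) ℝ} (hX : X.IsHermitian) :
    Gam m lam X = ∑ i : Fin d with i.val < m, 1 / (sortedEigenvalues hX i + lam) :=
  dif_pos hX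

theorem Gam_nonneg {X : Matrix (Fin d) (Fin d) ℝ} (hlam : 0 ≤ lam) (hX : X ∈ psdCone d) :
    0 ≤ Gam m lam X := by
  have hX : X.PosSemidef := hX
  rw [Gam_eq_sum hX.isHermitian]
  exact Finset.sum_nonneg fun i _ =>
    one_div_nonneg.2 (add_nonneg (sortedEigenvalues_nonneg hX i) hlam)

theorem monotone_one_div_add {ι : Type*} [Preorder ι] {τ : ι → ℝ} (hτ : Antitone τ)
    (h0 : ∀ i, 0 < τ i + lam) : Monotone fun i => 1 / (τ i + lam) :=
  fun _ j hij => one_div_le_one_div_of_le (h0 j) (by gcongr; exact hτ hij)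

theorem Gam_conj_diagonal_le (hlam : 0 < lam) {Q : Matrix (Fin d) (Fin d) ℝ}
    (hQ : Q ∈ orthogonalGroup (Fin d) ℝ) {τ : Fin d → ℝ} (h0 : ∀ i, 0 ≤ τ i)
    {S : Finset (Fin d)} (hS : S.card = m) :
    Gam m lam (Q * diagonal τ * Qᵀ) ≤ ∑ i ∈ S, 1 / (τ i + lam) := by
  have hX := (posSemidef_conj_diagonal_iff hQ).2 h0
  obtain ⟨V, hV⟩ := exists_isEigenDecomposition_sortedEigenvalues hX.isHermitian
  obtain ⟨e, he⟩ := exists_perm_of_conj_diagonal_eq hQ hV.orthogonal hV.eq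
  have monotone_terms := monotone_one_div_add (lam := lam) hV.antitone fun i =>
    add_pos_of_nonneg_of_pos (hV.nonneg hX i) hlam
  have isLowerSet_head : IsLowerSet (({i : Fin d | i.val < m} : Finset (Fin d)) : Set (Fin d)) := by
    intro i j hji hi
    simp only [Finset.coe_filter_univ, Set.mem_ofPred_eq] at hi ⊢
    exact (Fin.le_def.1 hji).trans_lt hi
  rw [Gam_eq_sum hX.isHermitian]
  calc ∑ i : Fin d with i.val < m, 1 / (sortedEigenvalues hX.isHermitian i + lam)
      ≤ ∑ i ∈ S.map e.toEmbedding, 1 / (sortedEigenvalues hX.isHermitian i + lam) :=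
        sum_le_sum_of_isLowerSet monotone_terms isLowerSet_head <| by
          rw [Finset.card_map, hS, card_filter_val_lt (hS ▸ card_finset_fin_le S)]
    _ = ∑ i ∈ S, 1 / (τ i + lam) := by
        rw [Finset.sum_map]
        exact Finset.sum_congr rfl fun i _ => by rw [congrFun he i]; rfl

end Gam

section BreakIndex

variable {d m η : ℕ} {σ : Fin d → ℝ}

/-- The common value `(1 / (m - η)) ∑_{i > η} σ_i` to which the eigenvalues after the `η`-th one are
levelled. -/
noncomputable def level (m : ℕ) (σ : Fin d → ℝ) (η : ℕ) : ℝ :=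
  tailSum σ η / ((m : ℝ) - η)

theorem tailSum_nonneg (h0 : ∀ i, 0 ≤ σ i) : 0 ≤ tailSum σ η :=
  Finset.sum_nonneg fun i _ => h0 i

theorem tailSum_val_eq_add (i : Fin d) : tailSum σ i = σ i + tailSum σ (i + 1) := by
  have tail_eq_insert : ({j | i.val ≤ j.val} : Finset (Fin d))
      = insert i ({j | i.val + 1 ≤ j.val} : Finset (Fin d)) := by
    ext j
    simp only [Finset.mem_filter_univ, Finset.mem_insert, Fin.ext_iff]
    omega
  rw [tailSum, tailSum, tail_eq_insert, Finset.sum_insert (by simp)]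

theorem sub_cast_pos (hη : η < m) : 0 < (m : ℝ) - η :=
  sub_pos.2 (Nat.cast_lt.2 hη)

theorem le_level_iff (hη : η < m) {a : ℝ} :
    a ≤ level m σ η ↔ ((m : ℝ) - η) * a ≤ tailSum σ η :=
  le_div_iff₀' (sub_cast_pos hη)

theorem sub_mul_level (hη : η < m) : ((m : ℝ) - η) * level m σ η = tailSum σ η :=
  mul_div_cancel₀ _ (sub_cast_pos hη).ne'

theorem level_nonneg (hη : η < m) (h0 : ∀ i, 0 ≤ σ i) : 0 ≤ level m σ η :=
  div_nonneg (tailSum_nonneg h0) (sub_cast_pos hη).le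

theorem le_level_succ_iff {i : Fin d} (hi : i.val + 1 < m) :
    σ i ≤ level m σ (i + 1) ↔ σ i ≤ level m σ i := by
  rw [le_level_iff hi, le_level_iff (by omega), tailSum_val_eq_add i]
  push_cast
  constructor <;> intro h <;> linarith

theorem le_level_of_le (hσ : Antitone σ) {i j : Fin d} (hij : i ≤ j) (hj : j.val < m)
    (hi : σ i ≤ level m σ i) : σ j ≤ level m σ j := by
  suffices ∀ n, i.val ≤ n → ∀ hn : n < d, n < m → σ ⟨n, hn⟩ ≤ level m σ n from
    this j hij j.2 hj
  intro n hin
  induction n, hin using Nat.le_induction with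
  | base => exact fun _ _ => hi
  | succ n _ ih =>
    intro hnd hnm
    calc σ ⟨n + 1, hnd⟩ ≤ σ ⟨n, by omega⟩ := hσ (Fin.mk_le_mk.2 n.le_succ)
      _ ≤ level m σ (n + 1) :=
        (le_level_succ_iff hnm).2 (ih (Nat.lt_of_succ_lt hnd) (Nat.lt_of_succ_lt hnm))

theorem isBreakIndex_val_iff_isLeast (hσ : Antitone σ) (i : Fin d) :
    IsBreakIndex m σ i ↔ IsLeast {j : Fin d | j.val < m ∧ σ j ≤ level m σ j} i := by
  have level_eq (n : ℕ) : 1 / ((m : ℝ) - n) * tailSum σ n = level m σ n :=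
    one_div_mul_eq_div ..
  constructor
  · rintro ⟨hlt, habove, hbelow⟩
    simp only [level_eq] at habove hbelow
    refine ⟨⟨hlt, hbelow i rfl⟩, fun j hj => ?_⟩
    by_contra! hji
    rw [Fin.lt_def] at hji
    obtain ⟨n, hn⟩ : ∃ n, n + 1 = i.val := ⟨i - 1, by omega⟩
    have le_level : σ ⟨n, by omega⟩ ≤ level m σ n :=
      le_level_of_le hσ (Fin.le_def.2 (by simp only; omega)) (by simp only; omega) hj.2
    rw [← le_level_succ_iff (by simp only; omega)] at le_level
    simp only [hn] at le_level
    exact (habove ⟨n, by omega⟩ hn).not_ge le_level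
  · rintro ⟨⟨hlt, hle⟩, hleast⟩
    refine ⟨hlt, fun j hj => ?_, fun j hj => ?_⟩
    · rw [level_eq, ← hj]
      by_contra! hle'
      rw [le_level_succ_iff (by omega)] at hle'
      have : i ≤ j := hleast ⟨by omega, hle'⟩
      rw [Fin.le_def] at this
      omega
    · rwa [level_eq, Fin.ext hj]

theorem existsUnique_isBreakIndex (hσ : Antitone σ) (h0 : ∀ i, 0 ≤ σ i) (hm : 1 ≤ m)
    (hmd : m ≤ d) : ∃! η, IsBreakIndex m σ η := by
  have last_mem : (⟨m - 1, by omega⟩ : Fin d) ∈ {j : Fin d | j.val < m ∧ σ j ≤ level m σ j} := by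
    have hlt : m - 1 < m := by omega
    refine ⟨hlt, (le_level_iff hlt).2 ?_⟩
    rw [tailSum_val_eq_add ⟨m - 1, by omega⟩, Nat.cast_sub hm]
    simpa using tailSum_nonneg h0
  obtain ⟨i, hi⟩ := (Set.toFinite _).isCompact.exists_isLeast ⟨_, last_mem⟩
  refine ⟨i, (isBreakIndex_val_iff_isLeast hσ i).2 hi, fun η hη => ?_⟩
  lift η to Fin d using hη.lt.trans_le hmd
  rw [((isBreakIndex_val_iff_isLeast hσ η).1 hη).unique hi]

theorem IsBreakIndex.le_level (h : IsBreakIndex m σ η) (hσ : Antitone σ) {i : Fin d}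
    (hi : η ≤ i.val) : σ i ≤ level m σ η := by
  lift η to Fin d using hi.trans_lt i.2
  exact (hσ hi).trans ((isBreakIndex_val_iff_isLeast hσ η).1 h).1.2

theorem IsBreakIndex.level_lt (h : IsBreakIndex m σ η) (hσ : Antitone σ) (hηd : η ≤ d) {i : Fin d}
    (hi : i.val < η) : level m σ η < σ i := by
  calc level m σ η = 1 / ((m : ℝ) - η) * tailSum σ η := (one_div_mul_eq_div ..).symm
    _ < σ ⟨η - 1, by omega⟩ := h.above _ (Nat.sub_add_cancel (by omega))
    _ ≤ σ i := hσ (Fin.le_def.2 (Nat.le_sub_one_of_lt hi))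

end BreakIndex

section Levelled

variable {d m η : ℕ} {σ : Fin d → ℝ} {lam : ℝ}

/-- The sequence `σ` with all entries after the `η`-th one replaced by `level m σ η`. -/
noncomputable def levelled (m : ℕ) (σ : Fin d → ℝ) (η : ℕ) (i : Fin d) : ℝ :=
  if i.val < η then σ i else level m σ η

theorem levelled_of_lt {i : Fin d} (hi : i.val < η) : levelled m σ η i = σ i :=
  if_pos hi

theorem levelled_of_le {i : Fin d} (hi : η ≤ i.val) : levelled m σ η i = level m σ η :=
  if_neg hi.not_gt

theorem levelled_nonneg (hη : η < m) (h0 : ∀ i, 0 ≤ σ i) (i : Fin d) : 0 ≤ levelled m σ η i := by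
  unfold levelled
  split_ifs
  exacts [h0 i, level_nonneg hη h0]

theorem IsBreakIndex.level_le_levelled (h : IsBreakIndex m σ η) (hσ : Antitone σ) (hηd : η ≤ d)
    (i : Fin d) : level m σ η ≤ levelled m σ η i := by
  unfold levelled
  split_ifs with hi
  exacts [(h.level_lt hσ hηd hi).le, le_rfl]

theorem IsBreakIndex.le_levelled (h : IsBreakIndex m σ η) (hσ : Antitone σ) (i : Fin d) :
    σ i ≤ levelled m σ η i := by
  unfold levelled
  split_ifs with hi
  exacts [le_rfl, h.le_level hσ (not_lt.1 hi)]

theorem IsBreakIndex.antitone_levelled (h : IsBreakIndex m σ η) (hσ : Antitone σ) (hηd : η ≤ d) :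
    Antitone (levelled m σ η) := by
  intro i j hij
  rcases lt_or_ge j.val η with hj | hj
  · rw [levelled_of_lt hj, levelled_of_lt ((Fin.le_def.1 hij).trans_lt hj)]
    exact hσ hij
  · rw [levelled_of_le hj]
    exact h.level_le_levelled hσ hηd i

theorem sum_comp_levelled {S : Finset (Fin d)} (hη : η < m) (hS : S.card = m)
    (hηS : {i : Fin d | i.val < η} ⊆ S) (f : ℝ → ℝ) :
    ∑ i ∈ S, f (levelled m σ η i)
      = ∑ i : Fin d with i.val < η, f (σ i) + ((m : ℝ) - η) * f (level m σ η) := by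
  have head_subset : ({i | i.val < η} : Finset (Fin d)) ⊆ S := by
    rwa [← Finset.coe_subset, Finset.coe_filter_univ]
  have hηd : η ≤ d := hη.le.trans (hS ▸ card_finset_fin_le S)
  have card_sdiff : ((S \ ({i | i.val < η} : Finset (Fin d))).card : ℝ) = (m : ℝ) - η := by
    rw [Finset.card_sdiff_of_subset head_subset, hS, card_filter_val_lt hηd, Nat.cast_sub hη.le]
  rw [← Finset.sum_sdiff head_subset, add_comm, ← card_sdiff, ← nsmul_eq_mul, ← Finset.sum_const]
  congr 1 <;> refine Finset.sum_congr rfl fun i hi => ?_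
  · rw [levelled_of_lt (by simpa using hi)]
  · rw [levelled_of_le]
    simpa using (Finset.mem_sdiff.1 hi).2

theorem sum_comp_levelled_mul {S : Finset (Fin d)} (hη : η < m) (hS : S.card = m)
    (hηS : {i : Fin d | i.val < η} ⊆ S) (f : ℝ → ℝ) :
    ∑ i, f (levelled m σ η i) * σ i = ∑ i ∈ S, f (levelled m σ η i) * levelled m σ η i := by
  rw [sum_comp_levelled hη hS hηS fun t => f t * t, mul_left_comm, sub_mul_level hη, tailSum,
    Finset.mul_sum, ← Finset.sum_filter_add_sum_filter_not Finset.univ fun i : Fin d => i.val < η]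
  simp only [not_lt]
  congr 1 <;> refine Finset.sum_congr rfl fun i hi => ?_
  · rw [levelled_of_lt (by simpa using hi)]
  · rw [levelled_of_le (by simpa using hi)]

theorem sub_div_tailSum_add (hη : η < m) :
    ((m : ℝ) - η) / (tailSum σ η + ((m : ℝ) - η) * lam) = 1 / (level m σ η + lam) := by
  rw [← sub_mul_level hη, ← mul_add, div_mul_cancel_left₀ (sub_cast_pos hη).ne', one_div]

theorem envelopeValue_eq_sum {S : Finset (Fin d)} (hη : η < m) (hS : S.card = m)
    (hηS : {i : Fin d | i.val < η} ⊆ S) :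
    envelopeValue m lam σ η = ∑ i ∈ S, 1 / (levelled m σ η i + lam) := by
  rw [sum_comp_levelled hη hS hηS fun t => 1 / (t + lam), ← sub_div_tailSum_add hη, envelopeValue,
    sq, mul_div_assoc]

theorem subgradValue_eq (hη : η < m) (i : Fin d) :
    subgradValue m lam σ η i = -(1 / (levelled m σ η i + lam)) ^ 2 := by
  unfold subgradValue levelled
  split_ifs
  · rfl
  · rw [sub_div_tailSum_add hη]

theorem IsBreakIndex.antitone_subgradValue (h : IsBreakIndex m σ η) (hσ : Antitone σ)
    (h0 : ∀ i, 0 ≤ σ i) (hηd : η ≤ d) (hlam : 0 < lam) : Antitone (subgradValue m lam σ η) := by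
  have levelled_add_pos (i : Fin d) : 0 < levelled m σ η i + lam :=
    add_pos_of_nonneg_of_pos (levelled_nonneg h.lt h0 i) hlam
  intro i j hij
  rw [subgradValue_eq h.lt, subgradValue_eq h.lt, neg_le_neg_iff]
  exact pow_le_pow_left₀ (one_div_nonneg.2 (levelled_add_pos i).le)
    (monotone_one_div_add (h.antitone_levelled hσ hηd) levelled_add_pos hij) 2

theorem setOf_val_lt_subset_filter_val_lt (hη : η ≤ m) :
    {i : Fin d | i.val < η} ⊆ (({i | i.val < m} : Finset (Fin d)) : Set (Fin d)) := by
  intro i hi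
  simpa using lt_of_lt_of_le hi hη

theorem IsBreakIndex.div_levelled_mem_hypersimplexFace (h : IsBreakIndex m σ η) (hσ : Antitone σ)
    (h0 : ∀ i, 0 ≤ σ i) (hmd : m ≤ d) (hpos : ∀ i, 0 < levelled m σ η i) :
    σ / levelled m σ η ∈ hypersimplexFace {i | i.val < η} m := by
  refine ⟨⟨⟨fun i => ?_, fun i => ?_⟩, ?_⟩, fun i hi => ?_⟩
  · exact div_nonneg (h0 i) (hpos i).le
  · exact (div_le_one (hpos i)).2 (h.le_levelled hσ i)
  · calc ∑ i, (σ / levelled m σ η) i = ∑ i, (levelled m σ η i)⁻¹ * σ i :=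
          Finset.sum_congr rfl fun i _ => div_eq_inv_mul ..
      _ = ∑ i : Fin d with i.val < m, (levelled m σ η i)⁻¹ * levelled m σ η i :=
          sum_comp_levelled_mul h.lt (card_filter_val_lt hmd)
            (setOf_val_lt_subset_filter_val_lt h.lt.le) _
      _ = ∑ i : Fin d with i.val < m, 1 :=
          Finset.sum_congr rfl fun i _ => inv_mul_cancel₀ (hpos i).ne'
      _ = m := by rw [Finset.sum_const, card_filter_val_lt hmd, nsmul_one]
  · have := (hpos i).ne'
    rw [levelled_of_lt hi] at this
    rw [Set.mem_singleton_iff, Pi.div_apply, levelled_of_lt hi, div_self this]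

theorem IsBreakIndex.exists_levelled_mul_eq (h : IsBreakIndex m σ η) (hσ : Antitone σ)
    (h0 : ∀ i, 0 ≤ σ i) (hmd : m ≤ d) :
    ∃ x ∈ hypersimplexFace {i : Fin d | i.val < η} m, levelled m σ η * x = σ := by
  rcases (level_nonneg h.lt h0).eq_or_lt with level_eq | level_pos
  · -- Here `σ` vanishes beyond `η`, and `σ / levelled m σ η` would be `0 / 0 = 0` there.
    refine ⟨_, indicator_one_mem_hypersimplexFace (card_filter_val_lt hmd)
      (setOf_val_lt_subset_filter_val_lt h.lt.le), funext fun i => ?_⟩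
    rcases lt_or_ge i.val η with hi | hi
    · simp [levelled_of_lt hi, hi.trans h.lt]
    · have := h.le_level hσ hi
      simp [levelled_of_le hi, ← level_eq, (this.trans_eq level_eq.symm).antisymm (h0 i)]
  · have levelled_pos (i : Fin d) : 0 < levelled m σ η i :=
      level_pos.trans_le (h.level_le_levelled hσ (h.lt.le.trans hmd) i)
    exact ⟨_, h.div_levelled_mem_hypersimplexFace hσ h0 hmd levelled_pos,
      funext fun i => mul_div_cancel₀ _ (levelled_pos i).ne'⟩

end Levelled

section Bounds

open Matrix

variable {d m η : ℕ} {σ : Fin d → ℝ} {lam : ℝ} {Q : Matrix (Fin d) (Fin d) ℝ}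

theorem convexOn_comp_conj_diagonal_mul {n : Type*} [Fintype n] [DecidableEq n]
    {s : Set (Matrix n n ℝ)} {g : Matrix n n ℝ → ℝ} (hg : ConvexOn ℝ s g) (Q : Matrix n n ℝ)
    (τ : n → ℝ) :
    ConvexOn ℝ {y | Q * diagonal (τ * y) * Qᵀ ∈ s} fun y => g (Q * diagonal (τ * y) * Qᵀ) :=
  hg.comp_linearMap (LinearMap.mulRight ℝ Qᵀ ∘ₗ LinearMap.mulLeft ℝ Q ∘ₗ
    diagonalLinearMap n ℝ ℝ ∘ₗ LinearMap.mulLeft ℝ τ)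

theorem IsBreakIndex.le_envelopeValue (h : IsBreakIndex m σ η) (hσ : Antitone σ)
    (h0 : ∀ i, 0 ≤ σ i) (hmd : m ≤ d) (hlam : 0 < lam) (hQ : Q ∈ orthogonalGroup (Fin d) ℝ)
    {g : Matrix (Fin d) (Fin d) ℝ → ℝ} (hg : ConvexOn ℝ (psdCone d) g)
    (hgGam : ∀ Z ∈ psdCone d, g Z ≤ Gam m lam Z) :
    g (Q * diagonal σ * Qᵀ) ≤ envelopeValue m lam σ η := by
  obtain ⟨x, hx, hxσ⟩ := h.exists_levelled_mul_eq hσ h0 hmd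
  let vertex (S : Finset (Fin d)) : Fin d → ℝ := levelled m σ η * (S : Set (Fin d)).indicator 1
  have vertex_nonneg (S : Finset (Fin d)) (i : Fin d) : 0 ≤ vertex S i :=
    mul_nonneg (levelled_nonneg h.lt h0 i) (Set.indicator_nonneg (fun _ _ => zero_le_one) i)
  have vertex_mem (S : Finset (Fin d)) : Q * diagonal (vertex S) * Qᵀ ∈ psdCone d :=
    (posSemidef_conj_diagonal_iff hQ).2 (vertex_nonneg S)
  obtain ⟨_, ⟨S, hS, hηS, rfl⟩, hgS⟩ :=
    (convexOn_comp_conj_diagonal_mul hg Q (levelled m σ η)).exists_ge_of_mem_convexHull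
      (by rintro _ ⟨S, -, -, rfl⟩; exact vertex_mem S) (hypersimplexFace_subset_convexHull hx)
  calc g (Q * diagonal σ * Qᵀ) = g (Q * diagonal (levelled m σ η * x) * Qᵀ) := by rw [hxσ]
    _ ≤ g (Q * diagonal (vertex S) * Qᵀ) := hgS
    _ ≤ Gam m lam (Q * diagonal (vertex S) * Qᵀ) := hgGam _ (vertex_mem S)
    _ ≤ ∑ i ∈ S, 1 / (vertex S i + lam) := Gam_conj_diagonal_le hlam hQ (vertex_nonneg S) hS
    _ = ∑ i ∈ S, 1 / (levelled m σ η i + lam) :=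
      Finset.sum_congr rfl fun i hi => by simp [vertex, hi]
    _ = envelopeValue m lam σ η := (envelopeValue_eq_sum h.lt hS hηS).symm

theorem one_div_sub_one_div_sq_mul_le {s t : ℝ} (hs : 0 < s) (ht : 0 < t) :
    1 / t - (1 / t) ^ 2 * (s - t) ≤ 1 / s := by
  have remainder : 1 / s - (1 / t - (1 / t) ^ 2 * (s - t)) = (s - t) ^ 2 / (s * t ^ 2) := by
    field_simp
    ring
  have : 0 ≤ (s - t) ^ 2 / (s * t ^ 2) := by positivity
  linarith

theorem envelopeValue_add_dotProduct_le (hη : η < m) (h0 : ∀ i, 0 ≤ σ i) (hlam : 0 < lam)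
    {S : Finset (Fin d)} (hS : S.card = m) (hηS : {i : Fin d | i.val < η} ⊆ S)
    {μ : Fin d → ℝ} (hμ : ∀ i, 0 ≤ μ i) :
    envelopeValue m lam σ η + subgradValue m lam σ η ⬝ᵥ (μ - σ) ≤ ∑ i ∈ S, 1 / (μ i + lam) := by
  set w := subgradValue m lam σ η
  have w_eq (i : Fin d) : w i = -(1 / (levelled m σ η i + lam)) ^ 2 := subgradValue_eq hη i
  have dotProduct_σ : w ⬝ᵥ σ = ∑ i ∈ S, w i * levelled m σ η i := by
    simpa only [dotProduct, w_eq] using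
      sum_comp_levelled_mul hη hS hηS fun t => -(1 / (t + lam)) ^ 2
  have dotProduct_μ : w ⬝ᵥ μ ≤ ∑ i ∈ S, w i * μ i := by
    refine (Finset.sum_add_sum_compl S _).ge.trans <|
      add_le_of_nonpos_right <| Finset.sum_nonpos fun i _ => ?_
    exact mul_nonpos_of_nonpos_of_nonneg ((w_eq i).trans_le (neg_nonpos.2 (sq_nonneg _))) (hμ i)
  have tangent_le (i : Fin d) :
      1 / (levelled m σ η i + lam) + (w i * μ i - w i * levelled m σ η i) ≤ 1 / (μ i + lam) := by
    have := one_div_sub_one_div_sq_mul_le (add_pos_of_nonneg_of_pos (hμ i) hlam)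
      (add_pos_of_nonneg_of_pos (levelled_nonneg hη h0 i) hlam)
    rw [w_eq]
    linarith
  calc envelopeValue m lam σ η + w ⬝ᵥ (μ - σ)
      ≤ ∑ i ∈ S, 1 / (levelled m σ η i + lam)
          + (∑ i ∈ S, w i * μ i - ∑ i ∈ S, w i * levelled m σ η i) := by
        rw [dotProduct_sub, dotProduct_σ, envelopeValue_eq_sum hη hS hηS]
        gcongr
    _ = ∑ i ∈ S, (1 / (levelled m σ η i + lam) + (w i * μ i - w i * levelled m σ η i)) := by
        rw [Finset.sum_add_distrib, Finset.sum_sub_distrib]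
    _ ≤ ∑ i ∈ S, 1 / (μ i + lam) := Finset.sum_le_sum fun i _ => tangent_le i

theorem IsBreakIndex.envelopeValue_add_trace_le (h : IsBreakIndex m σ η) (hσ : Antitone σ)
    (h0 : ∀ i, 0 ≤ σ i) (hmd : m ≤ d) (hlam : 0 < lam) (hQ : Q ∈ orthogonalGroup (Fin d) ℝ)
    {Y : Matrix (Fin d) (Fin d) ℝ} (hY : Y ∈ psdCone d) :
    envelopeValue m lam σ η + (Q * diagonal (subgradValue m lam σ η) * Qᵀ *
      (Y - Q * diagonal σ * Qᵀ)).trace ≤ Gam m lam Y := by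
  have hY : Y.PosSemidef := hY
  obtain ⟨V, hV⟩ := exists_isEigenDecomposition_sortedEigenvalues hY.isHermitian
  have antitone_subgrad : Antitone (subgradValue m lam σ η) :=
    h.antitone_subgradValue hσ h0 (h.lt.le.trans hmd) hlam
  calc _ ≤ envelopeValue m lam σ η
          + subgradValue m lam σ η ⬝ᵥ (sortedEigenvalues hY.isHermitian - σ) := by
        rw [Matrix.mul_sub, trace_sub, dotProduct_sub,
          trace_conj_diagonal_mul_conj_diagonal_self hQ]
        nth_rw 1 [hV.eq]
        gcongr
        exact trace_conj_diagonal_mul_conj_diagonal_le hQ hV.orthogonal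
          (antitone_subgrad.monovary hV.antitone)
    _ ≤ ∑ i : Fin d with i.val < m, 1 / (sortedEigenvalues hY.isHermitian i + lam) :=
        envelopeValue_add_dotProduct_le h.lt h0 hlam (card_filter_val_lt hmd)
          (setOf_val_lt_subset_filter_val_lt h.lt.le) (sortedEigenvalues_nonneg hY)
    _ = Gam m lam Y := (Gam_eq_sum hY.isHermitian).symm

theorem convexOn_add_trace_mul_sub {n : Type*} [Fintype n] {s : Set (Matrix n n ℝ)}
    (hs : Convex ℝ s) (c : ℝ) (W X : Matrix n n ℝ) :
    ConvexOn ℝ s fun Y => c + (W * (Y - X)).trace := by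
  refine ⟨hs, fun Y _ Z _ a b _ _ hab => le_of_eq ?_⟩
  simp only [Matrix.mul_sub, Matrix.mul_add, Matrix.mul_smul, trace_sub, trace_add, trace_smul,
    smul_eq_mul]
  linear_combination (-(c - (W * X).trace)) * hab

end Bounds

section Envelope

open Matrix

variable {d m η : ℕ} {σ : Fin d → ℝ} {lam : ℝ} {X Q : Matrix (Fin d) (Fin d) ℝ}
  {g : Matrix (Fin d) (Fin d) ℝ → ℝ}

theorem isConvexEnvelopeOn_convexEnvelopeOn_Gam (hlam : 0 ≤ lam) :
    IsConvexEnvelopeOn (psdCone d) (Gam m lam) (convexEnvelopeOn (psdCone d) (Gam m lam)) :=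
  isConvexEnvelopeOn_convexEnvelopeOn (convexOn_const 0 (convex_psdCone d))
    fun _ hZ => Gam_nonneg hlam hZ

theorem IsBreakIndex.envelopeValue_add_trace_le_of_isConvexEnvelopeOn (h : IsBreakIndex m σ η)
    (hg : IsConvexEnvelopeOn (psdCone d) (Gam m lam) g) (hX : X ∈ psdCone d)
    (hXσ : IsEigenDecomposition X Q σ) (hmd : m ≤ d) (hlam : 0 < lam)
    {Y : Matrix (Fin d) (Fin d) ℝ} (hY : Y ∈ psdCone d) :
    envelopeValue m lam σ η + (Q * diagonal (subgradValue m lam σ η) * Qᵀ * (Y - X)).trace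
      ≤ g Y := by
  refine hg.greatest _ (convexOn_add_trace_mul_sub (convex_psdCone d) _ _ X) (fun Z hZ => ?_) Y hY
  rw [hXσ.eq]
  exact h.envelopeValue_add_trace_le hXσ.antitone (hXσ.nonneg hX) hmd hlam hXσ.orthogonal hZ

theorem IsConvexEnvelopeOn.eq_envelopeValue (hg : IsConvexEnvelopeOn (psdCone d) (Gam m lam) g)
    (hX : X ∈ psdCone d) (hXσ : IsEigenDecomposition X Q σ) (hη : IsBreakIndex m σ η)
    (hmd : m ≤ d) (hlam : 0 < lam) : g X = envelopeValue m lam σ η := by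
  apply le_antisymm
  · rw [hXσ.eq]
    exact hη.le_envelopeValue hXσ.antitone (hXσ.nonneg hX) hmd hlam hXσ.orthogonal hg.convexOn hg.le
  · simpa using hη.envelopeValue_add_trace_le_of_isConvexEnvelopeOn hg hX hXσ hmd hlam hX

theorem IsConvexEnvelopeOn.isSubgradient (hg : IsConvexEnvelopeOn (psdCone d) (Gam m lam) g)
    (hX : X ∈ psdCone d) (hXσ : IsEigenDecomposition X Q σ) (hη : IsBreakIndex m σ η)
    (hmd : m ≤ d) (hlam : 0 < lam) :
    IsSubgradient g X (Q * diagonal (subgradValue m lam σ η) * Qᵀ) := by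
  have isSymm : (Q * diagonal (subgradValue m lam σ η) * Qᵀ).IsSymm := isHermitian_conj_diagonal
  refine ⟨isSymm, fun Y hY => ?_⟩
  rw [hg.eq_envelopeValue hX hXσ hη hmd hlam, isSymm.eq]
  exact hη.envelopeValue_add_trace_le_of_isConvexEnvelopeOn hg hX hXσ hmd hlam hY

end Envelope

theorem proposition3 (d k : ℕ) (hd : 1 ≤ d) (hk : 1 ≤ k) (lam : ℝ) (hlam : 0 < lam) :
    IsConvexEnvelopeOn (psdCone d) (Gam (min k d) lam)
        (convexEnvelopeOn (psdCone d) (Gam (min k d) lam)) ∧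
      ∀ (X Q : Matrix (Fin d) (Fin d) ℝ) (σ : Fin d → ℝ),
        X ∈ psdCone d → IsEigenDecomposition X Q σ →
          ∃ η : ℕ,
            (IsBreakIndex (min k d) σ η ∧ ∀ η' : ℕ, IsBreakIndex (min k d) σ η' → η' = η) ∧
            convexEnvelopeOn (psdCone d) (Gam (min k d) lam) X
              = envelopeValue (min k d) lam σ η ∧
            IsSubgradient (convexEnvelopeOn (psdCone d) (Gam (min k d) lam)) X
              (Q * Matrix.diagonal (subgradValue (min k d) lam σ η) * Qᵀ) := by
  have hmd : min k d ≤ d := min_le_right k d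
  have henv := isConvexEnvelopeOn_convexEnvelopeOn_Gam (d := d) (m := min k d) hlam.le
  refine ⟨henv, fun X Q σ hX hXσ => ?_⟩
  obtain ⟨η, hη, hunique⟩ :=
    existsUnique_isBreakIndex hXσ.antitone (hXσ.nonneg hX) (le_min hk hd) hmd
  exact ⟨η, ⟨hη, hunique⟩, henv.eq_envelopeValue hX hXσ hη hmd hlam,
    henv.isSubgradient hX hXσ hη hmd hlam⟩
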